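/- There exist a real number $C_0$ and a natural number $N_0$ such that the following holds for all real $C \ge C_0$ and all integers $m \ge n \ge N_0$ with $n \ge C\log(n+m)$ (natural logarithm). Let $G$ be a copy of the complete bipartite graph $K_{n,m}$ whose edges are colored arbitrarily (the coloring need not be proper), in such a way that each color appears on at most $n/2$ edges. Then $G$ contains at least $$\left\lfloor \frac{n}{C\log(n+m)} \right\rfloor$$ pairwise edge-disjoint rainbow spanning trees, where a rainbow spanning tree is a spanning tree of $G$ no two of whose edges have the same color. -/

import Mathlib

/-- For an edge-coloring `c` of `G` (an arbitrary map from the edges of `G` to a type of colors),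
`T` is a rainbow spanning tree of `G`: it is a subgraph of `G` on the whole vertex set, it is a
tree, and distinct edges of `T` have distinct colors. -/
def IsRainbowSpanningTree {V κ : Type*} {G : SimpleGraph V} (c : G.EdgeLabeling κ)
    (T : SimpleGraph V) : Prop :=
  T ≤ G ∧ T.IsTree ∧ Set.InjOn c {e : G.edgeSet | (e : Sym2 V) ∈ T.edgeSet}

/-- `G`, with the edge-coloring `c`, contains (at least) `q` pairwise edge-disjoint rainbow
spanning trees. -/
def HasEdgeDisjointRainbowSpanningTrees {V κ : Type*} {G : SimpleGraph V} (c : G.EdgeLabeling κ)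
    (q : ℕ) : Prop :=
  ∃ T : Fin q → SimpleGraph V,
    (∀ i, IsRainbowSpanningTree c (T i)) ∧
      ∀ i j, i ≠ j → Disjoint (T i).edgeSet (T j).edgeSet

/-! Give every edge one of `q` labels uniformly at random. Label classes are disjoint, so it
suffices that with positive probability every class contains a rainbow spanning tree. By matroid
intersection (graphic against partition matroid, `exists_rainbow_tree`), a class contains one as
soon as, for each partition of the vertices into `t` parts, its crossing edges carry at least `t -
1` colors.

If this fails for label `i`, some set `S` of at most `t - 2` colors contains the colors of all
crossing edges labelled `i`. So `i` misses the set `Y` of crossing edges with color outside `S`, an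
event of probability at most `exp (-#Y / q)`. A union bound over label, partition and `S` succeeds
because `#Y ≥ n * d / 60`, where `d` measures how far the pair is from an extreme one: from
singletons and all colors (`card_missed_of_fine`), or from a single part and no color
(`card_missed_of_coarse`). Each event then costs at most `N ^ (-4 * d)` with `N = n + m`, and these
weights sum to less than 1 (`sum_missing_weights_lt_one`).

Merging small color classes beforehand bounds the number of colors outside `S` by the edges they
carry; a tree rainbow for the merged coloring is rainbow for the original one. -/

/-! ### Matroid rank functions and matroid intersection. -/

/-- A rank function of a matroid on the finite subsets of `E`. -/
structure IsRankFunction {E : Type*} [DecidableEq E] (r : Finset E → ℤ) : Prop where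
  empty : r ∅ = 0
  mono : ∀ A B, A ⊆ B → r A ≤ r B
  submodular : ∀ A B, r (A ∪ B) + r (A ∩ B) ≤ r A + r B
  insert_le : ∀ e A, r (insert e A) ≤ r A + 1

namespace IsRankFunction

variable {E : Type*} [DecidableEq E] {r r₁ r₂ : Finset E → ℤ}

theorem singleton_eq_one (hr : IsRankFunction r) {e : E} {A : Finset E}
    (h : r A + 1 ≤ r (insert e A)) : r {e} = 1 := by
  have h1 := hr.insert_le e ∅
  have h2 := hr.submodular {e} A
  have h3 := hr.mono ∅ ({e} ∩ A) (Finset.empty_subset _)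
  rw [hr.empty] at h1 h3
  rw [← Finset.insert_eq] at h2
  simp only [insert_empty_eq] at h1
  omega

theorem contract (hr : IsRankFunction r) {e : E} (he : r {e} = 1) :
    IsRankFunction fun A => r (insert e A) - 1 where
  empty := by simp [he]
  mono A B h := by
    have := hr.mono _ _ (Finset.insert_subset_insert e h)
    omega
  submodular A B := by
    have := hr.submodular (insert e A) (insert e B)
    rw [← Finset.insert_union_distrib, ← Finset.insert_inter_distrib] at this
    omega
  insert_le x A := by
    have := hr.insert_le x (insert e A)
    rw [Finset.insert_comm] at this
    omega

/-- The matroid intersection theorem, in the nontrivial direction. -/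
theorem exists_common_independent (h₁ : IsRankFunction r₁) (h₂ : IsRankFunction r₂)
    (X : Finset E) (k : ℤ) (h : ∀ A ⊆ X, k ≤ r₁ A + r₂ (X \ A)) :
    ∃ I ⊆ X, k ≤ (I.card : ℤ) ∧ r₁ I = I.card ∧ r₂ I = I.card := by
  induction X using Finset.induction_on generalizing r₁ r₂ k with
  | empty =>
    refine ⟨∅, subset_rfl, ?_, by simp [h₁.empty], by simp [h₂.empty]⟩
    simpa [h₁.empty, h₂.empty] using h ∅ subset_rfl
  | insert e X he ih =>
    -- If the bound survives deleting `e`, induct on the deletion. Otherwise a violating `A` shows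
    -- that `e` is a loop of neither matroid, and the contraction by `e` satisfies the bound for `k
    -- - 1`.
    by_cases hA : ∀ A ⊆ X, k ≤ r₁ A + r₂ (X \ A)
    · obtain ⟨I, hI, h'⟩ := ih h₁ h₂ k hA
      exact ⟨I, hI.trans (Finset.subset_insert _ _), h'⟩
    push Not at hA
    obtain ⟨A, hAX, hA⟩ := hA
    have hd : ∀ B ⊆ X, k ≤ r₁ B + r₂ (insert e (X \ B)) := fun B hB => by
      have := h B (hB.trans (Finset.subset_insert _ _))
      rwa [Finset.insert_sdiff_of_notMem _ fun h' => he (hB h')] at this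
    have hc : ∀ B ⊆ X, k ≤ r₁ (insert e B) + r₂ (X \ B) := fun B hB => by
      have := h (insert e B) (Finset.insert_subset_insert _ hB)
      rwa [Finset.insert_sdiff_insert, Finset.sdiff_insert_of_notMem he] at this
    have e₁ : r₁ {e} = 1 := h₁.singleton_eq_one (A := A) (by linarith [hc A hAX])
    have e₂ : r₂ {e} = 1 := h₂.singleton_eq_one (A := X \ A) (by linarith [hd A hAX])
    -- Uncrossing: a set `B` violating the bound in the contraction, together with `A`, would by
    -- submodularity contradict the hypothesis at `A ∩ B` or at `insert e (A ∪ B)`.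
    obtain ⟨I, hI, hk, hI₁, hI₂⟩ := ih (h₁.contract e₁) (h₂.contract e₂) (k - 1) (by
      intro B hB
      have s₁ := h₁.submodular A (insert e B)
      have s₂ := h₂.submodular (X \ A) (insert e (X \ B))
      rw [Finset.union_insert, Finset.inter_insert_of_notMem fun h' => he (hAX h')] at s₁
      rw [Finset.union_insert, Finset.inter_insert_of_notMem (by simp [he]),
        ← Finset.sdiff_inter_distrib_right, ← Finset.sdiff_union_distrib] at s₂
      have := hd (A ∩ B) (Finset.inter_subset_left.trans hAX)
      have := hc (A ∪ B) (Finset.union_subset hAX hB)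
      linarith)
    have heI : e ∉ I := fun h' => he (hI h')
    refine ⟨insert e I, Finset.insert_subset_insert _ hI, ?_, ?_, ?_⟩ <;>
      rw [Finset.card_insert_of_notMem heI] <;> push_cast <;> linarith

end IsRankFunction

/-! ### Partition and graphic matroids; rainbow trees by intersection. -/

/-- The rank function of a partition matroid: the number of colors of a set. -/
theorem isRankFunction_card_image {E κ : Type*} [DecidableEq E] [DecidableEq κ] (c : E → κ) :
    IsRankFunction fun A : Finset E => ((A.image c).card : ℤ) where
  empty := by simp
  mono A B h := by exact_mod_cast Finset.card_le_card (Finset.image_subset_image h)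
  submodular A B := by
    have h1 := Finset.card_union_add_card_inter (A.image c) (B.image c)
    have h2 := Finset.card_le_card (Finset.image_inter_subset c A B)
    rw [← Finset.image_union] at h1
    exact_mod_cast (by omega : _ + _ ≤ _ + _)
  insert_le e A := by
    rw [Finset.image_insert]
    exact_mod_cast Finset.card_insert_le _ _

/-- The rational functions on the vertices that are constant along every edge in `A`, in the
multigraph whose edge `e` has ends `s e` and `t e`. -/
def edgeInvariants {V E : Type*} (s t : E → V) (A : Finset E) : Submodule ℚ (V → ℚ) where
  carrier := {x | ∀ e ∈ A, x (s e) = x (t e)}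
  add_mem' hx hy e he := by simp [hx e he, hy e he]
  zero_mem' e _ := rfl
  smul_mem' a x hx e he := by simp [hx e he]

/-- The graph with the edges in `A`, in the multigraph whose edge `e` has ends `s e` and `t e`. -/
def edgeGraph {V E : Type*} (s t : E → V) (A : Finset E) : SimpleGraph V :=
  SimpleGraph.fromEdgeSet ((fun e => s(s e, t e)) '' A)

section Graphic

variable {V E : Type*} (s t : E → V)

theorem mem_edgeInvariants {A : Finset E} {x : V → ℚ} :
    x ∈ edgeInvariants s t A ↔ ∀ e ∈ A, x (s e) = x (t e) := Iff.rfl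

theorem edgeGraph_reachable {A : Finset E} {e : E} (he : e ∈ A) :
    (edgeGraph s t A).Reachable (s e) (t e) := by
  by_cases h : s e = t e
  · rw [h]
  · exact SimpleGraph.Adj.reachable ((SimpleGraph.fromEdgeSet_adj _).2 ⟨⟨e, he, rfl⟩, h⟩)

theorem eq_of_reachable {A : Finset E} {x : V → ℚ} (hx : x ∈ edgeInvariants s t A) {u v : V}
    (h : (edgeGraph s t A).Reachable u v) : x u = x v := by
  obtain ⟨p⟩ := h
  induction p with
  | nil => rfl
  | cons hadj _ ih =>
    rw [← ih]
    obtain ⟨⟨e, he, h⟩, -⟩ := (SimpleGraph.fromEdgeSet_adj _).1 hadj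
    rcases Sym2.eq_iff.1 h with ⟨rfl, rfl⟩ | ⟨rfl, rfl⟩
    · exact hx e he
    · exact (hx e he).symm

variable [Fintype V]

/-- The space of invariants has dimension the number of components, so this is the usual graphic
rank. Submodularity becomes the dimension formula for a sum and an intersection, and a new edge
imposes one linear condition. -/
theorem isRankFunction_graphic [DecidableEq E] :
    IsRankFunction fun A : Finset E =>
      (Fintype.card V : ℤ) - Module.finrank ℚ (edgeInvariants s t A) where
  empty := by
    have : edgeInvariants s t (∅ : Finset E) = ⊤ := by
      ext x; simp [mem_edgeInvariants]
    rw [this, finrank_top, Module.finrank_fintype_fun_eq_card, sub_self]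
  mono A B h := by
    have : Module.finrank ℚ (edgeInvariants s t B) ≤ Module.finrank ℚ (edgeInvariants s t A) :=
      Submodule.finrank_mono fun x hx e he => hx e (h he)
    omega
  submodular A B := by
    have h1 := Submodule.finrank_sup_add_finrank_inf_eq (edgeInvariants s t A)
      (edgeInvariants s t B)
    have h2 : edgeInvariants s t A ⊓ edgeInvariants s t B = edgeInvariants s t (A ∪ B) := by
      ext x
      simp only [Submodule.mem_inf, mem_edgeInvariants, Finset.mem_union]
      exact ⟨fun h e => fun he => he.elim (h.1 e) (h.2 e),
        fun h => ⟨fun e he => h e (Or.inl he), fun e he => h e (Or.inr he)⟩⟩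
    have h3 : edgeInvariants s t A ⊔ edgeInvariants s t B ≤ edgeInvariants s t (A ∩ B) :=
      sup_le (fun x hx e he => hx e (Finset.mem_inter.1 he).1)
        fun x hx e he => hx e (Finset.mem_inter.1 he).2
    have h4 := Submodule.finrank_mono h3
    rw [h2] at h1
    omega
  insert_le e A := by
    let φ : (V → ℚ) →ₗ[ℚ] ℚ :=
      LinearMap.proj (R := ℚ) (φ := fun _ : V => ℚ) (s e) - LinearMap.proj (t e)
    have h1 := LinearMap.finrank_range_add_finrank_ker (φ.domRestrict (edgeInvariants s t A))
    have h2 : Module.finrank ℚ (LinearMap.range (φ.domRestrict (edgeInvariants s t A))) ≤ 1 :=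
      (Submodule.finrank_le _).trans (Module.finrank_self ℚ).le
    have h3 : Module.finrank ℚ (LinearMap.ker (φ.domRestrict (edgeInvariants s t A))) ≤
        Module.finrank ℚ (edgeInvariants s t (insert e A)) := by
      refine LinearMap.finrank_le_finrank_of_injective
        (f := LinearMap.codRestrict (edgeInvariants s t (insert e A))
          ((edgeInvariants s t A).subtype ∘ₗ (LinearMap.ker _).subtype) ?_) ?_
      · rintro ⟨⟨x, hx⟩, hxe⟩ e' he'
        rcases Finset.mem_insert.1 he' with rfl | he'
        · simpa [φ, sub_eq_zero] using hxe
        · exact hx e' he'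
      · intro x y hxy
        exact Subtype.ext (Subtype.ext (congrArg (fun z : edgeInvariants s t (insert e A) => z.1) hxy))
    omega

/-- Partitions are encoded as idempotent maps sending each vertex to a representative of its part;
here the parts are the components. An invariant function is determined by its values on
representatives. -/
theorem exists_idempotent_of_edges [DecidableEq V] (A : Finset E) :
    ∃ f : V → V, (∀ v, f (f v) = f v) ∧ (∀ e ∈ A, f (s e) = f (t e)) ∧
      Module.finrank ℚ (edgeInvariants s t A) ≤ (Finset.univ.image f).card := by
  let f : V → V := fun v => ((edgeGraph s t A).connectedComponentMk v).out
  have hf : ∀ v, (edgeGraph s t A).Reachable (f v) v := fun v =>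
    SimpleGraph.ConnectedComponent.exact (Quot.out_eq _)
  have hf' : ∀ u v, (edgeGraph s t A).Reachable u v → f u = f v := fun u v h =>
    congrArg Quot.out (SimpleGraph.ConnectedComponent.sound h)
  refine ⟨f, fun v => hf' _ _ (hf v), fun e he => hf' _ _ (edgeGraph_reachable s t he), ?_⟩
  have h1 : Module.finrank ℚ (edgeInvariants s t A) ≤
      Module.finrank ℚ (↥(Finset.univ.image f) → ℚ) := by
    refine LinearMap.finrank_le_finrank_of_injective
      (f := (LinearMap.funLeft ℚ ℚ (fun v : ↥(Finset.univ.image f) => (v : V))).comp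
        (edgeInvariants s t A).subtype) ?_
    rintro ⟨x, hx⟩ ⟨y, hy⟩ hxy
    refine Subtype.ext (funext fun v => ?_)
    have := congrFun hxy ⟨f v, Finset.mem_image_of_mem f (Finset.mem_univ v)⟩
    simp only [LinearMap.comp_apply, LinearMap.funLeft_apply, Submodule.subtype_apply] at this
    exact (eq_of_reachable s t hx (hf v)).symm.trans (this.trans (eq_of_reachable s t hy (hf v)))
  rwa [Module.finrank_fintype_fun_eq_card, Fintype.card_coe] at h1

theorem edgeGraph_isTree [Nonempty V] (A : Finset E)
    (h : Module.finrank ℚ (edgeInvariants s t A) ≤ 1) (hA : A.card + 1 ≤ Fintype.card V) :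
    (edgeGraph s t A).IsTree := by
  classical
  have hconn : (edgeGraph s t A).Connected := by
    refine ⟨fun u v => ?_⟩
    -- The indicator of a component and the constant 1 are both invariant; in dimension at most one
    -- they are proportional, so the component is everything.
    let x : edgeInvariants s t A := ⟨fun w => if (edgeGraph s t A).Reachable u w then 1 else 0, by
      intro e he
      have : (edgeGraph s t A).Reachable u (s e) ↔ (edgeGraph s t A).Reachable u (t e) :=
        ⟨fun h => h.trans (edgeGraph_reachable s t he),
          fun h => h.trans (edgeGraph_reachable s t he).symm⟩
      simp only [this]⟩
    let y : edgeInvariants s t A := ⟨fun _ => 1, fun _ _ => rfl⟩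
    obtain ⟨z, hz⟩ := finrank_le_one_iff.1 h
    obtain ⟨a, ha⟩ := hz x
    obtain ⟨b, hb⟩ := hz y
    have hb' : ∀ w, b * z.1 w = 1 := fun w => congrFun (congrArg Subtype.val hb) w
    have ha' : ∀ w, a * z.1 w = if (edgeGraph s t A).Reachable u w then 1 else 0 :=
      fun w => congrFun (congrArg Subtype.val ha) w
    have hb0 : b ≠ 0 := fun h0 => by simpa [h0] using hb' u
    have huv : z.1 u = z.1 v := mul_left_cancel₀ hb0 ((hb' u).trans (hb' v).symm)
    by_contra hn
    have h1 := ha' u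
    have h2 := ha' v
    rw [if_neg hn, ← huv, h1, if_pos (SimpleGraph.Reachable.refl u)] at h2
    exact one_ne_zero h2
  refine SimpleGraph.isTree_iff_connected_and_card.2 ⟨hconn, ?_⟩
  have h1 := hconn.card_vert_le_card_edgeSet_add_one
  have h2 : Nat.card (edgeGraph s t A).edgeSet ≤ A.card := by
    rw [Nat.card_coe_set_eq, edgeGraph, SimpleGraph.edgeSet_fromEdgeSet]
    refine (Set.ncard_le_ncard Set.sdiff_subset (A.finite_toSet.image _)).trans ?_
    exact (Set.ncard_image_le A.finite_toSet).trans (Set.ncard_coe_finset A).le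
  rw [Nat.card_eq_fintype_card (α := V)] at h1 ⊢
  omega

/-- A sufficient condition for a rainbow spanning tree inside a set `X` of edges. -/
theorem exists_rainbow_tree [DecidableEq E] [Nonempty V] [DecidableEq V] {κ : Type*} [DecidableEq κ] (c : E → κ)
    (X : Finset E)
    (h : ∀ f : V → V, (∀ v, f (f v) = f v) → (Finset.univ.image f).card ≤
      ((X.filter fun e => f (s e) ≠ f (t e)).image c).card + 1) :
    ∃ I ⊆ X, (edgeGraph s t I).IsTree ∧ Set.InjOn c I := by
  obtain ⟨I, hIX, hk, h1, h2⟩ := (isRankFunction_graphic s t).exists_common_independent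
    (isRankFunction_card_image c) X (Fintype.card V - 1) (by
      intro A hA
      obtain ⟨f, hf, hfA, hcard⟩ := exists_idempotent_of_edges s t A
      have h1 := h f hf
      have h2 : ((X.filter fun e => f (s e) ≠ f (t e)).image c).card ≤
          ((X \ A).image c).card := by
        refine Finset.card_le_card (Finset.image_subset_image fun e he => ?_)
        rw [Finset.mem_filter] at he
        exact Finset.mem_sdiff.2 ⟨he.1, fun h' => he.2 (hfA e h')⟩
      omega)
  refine ⟨I, hIX, edgeGraph_isTree s t I (by omega) ?_, Finset.card_image_iff.1 (by omega)⟩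
  have : Module.finrank ℚ (edgeInvariants s t I) ≠ 0 := fun h0 => by
    have hbot := Submodule.finrank_eq_zero.1 h0
    have hmem : (fun _ : V => (1 : ℚ)) ∈ edgeInvariants s t I := fun _ _ => rfl
    rw [hbot, Submodule.mem_bot] at hmem
    exact one_ne_zero (congrFun hmem (Classical.arbitrary V))
  omega

end Graphic

/-! ### Merging small color classes. -/

open Finset in
/-- Color classes can be merged, keeping the bound on their sizes, until any two of them together
exceed the bound. -/
theorem exists_merged_coloring {E κ : Type*} [Fintype E] [DecidableEq E] [DecidableEq κ]
    (c : E → κ) (n : ℕ) (hc : ∀ k, 2 * #{e | c e = k} ≤ n) :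
    ∃ d : E → E, (∀ e e', c e = c e' → d e = d e') ∧ (∀ k, 2 * #{e | d e = k} ≤ n) ∧
      ∀ k ∈ univ.image d, ∀ l ∈ univ.image d, k ≠ l →
        n < 2 * (#{e | d e = k} + #{e | d e = l}) := by
  let P : Set (E → E) :=
    {d | (∀ e e', c e = c e' → d e = d e') ∧ (∀ k, 2 * #{e | d e = k} ≤ n)}
  have hP : P.Nonempty := by
    -- Renaming each color to a chosen edge of that color puts the colorings in the finite type `E →
    -- E`, where a minimum exists. The default `e` is never reached.
    let g : κ → E → E := fun k e => if h : ∃ e', c e' = k then h.choose else e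
    have hg : ∀ e, c (g (c e) e) = c e := fun e => by
      have h : ∃ e', c e' = c e := ⟨e, rfl⟩
      simp only [g, dif_pos h]
      exact h.choose_spec
    refine ⟨fun e => g (c e) e, fun e e' h => ?_, fun k => ?_⟩
    · have h1 : ∃ x, c x = c e' := ⟨e', rfl⟩
      simp only [g, h, dif_pos h1]
    · refine (Nat.mul_le_mul_left 2 (card_le_card fun e he => ?_)).trans (hc (c k))
      rw [mem_filter] at he ⊢
      exact ⟨he.1, by rw [← he.2, hg]⟩
  -- With the fewest colors, no two classes can still be merged within the bound.
  obtain ⟨d, hd, hmin⟩ := P.toFinite.exists_minimalFor (fun d => #(univ.image d)) P hP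
  refine ⟨d, hd.1, hd.2, fun k hk l hl hkl => ?_⟩
  by_contra! hle
  let d' : E → E := fun e => if d e = l then k else d e
  have hd' : d' ∈ P := by
    refine ⟨fun e e' h => by simp only [d', hd.1 e e' h], fun x => ?_⟩
    by_cases hx : x = k
    · subst hx
      refine (Nat.mul_le_mul_left 2 ((card_le_card fun e he => ?_).trans
        (card_union_le _ _))).trans hle
      simp only [d', mem_filter, mem_univ, true_and, mem_union] at he ⊢
      split_ifs at he with h
      · exact Or.inr h
      · exact Or.inl he
    · refine (Nat.mul_le_mul_left 2 (card_le_card fun e he => ?_)).trans (hd.2 x)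
      simp only [d', mem_filter, mem_univ, true_and] at he ⊢
      split_ifs at he with h
      · exact absurd he.symm hx
      · exact he
  have hsub : univ.image d' ⊆ (univ.image d).erase l := by
    intro x hx
    obtain ⟨e, -, rfl⟩ := mem_image.1 hx
    simp only [d', mem_erase]
    split_ifs with h
    · exact ⟨hkl, hk⟩
    · exact ⟨h, mem_image_of_mem d (mem_univ e)⟩
  have h1 := card_le_card hsub
  rw [card_erase_of_mem hl] at h1
  have h2 : 0 < #(univ.image d) := card_pos.2 ⟨l, hl⟩
  have h3 : #(univ.image d) ≤ #(univ.image d') := hmin hd' (by dsimp only; omega)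
  omega

/-! ### Counting crossing edges that avoid a set of colors. -/

section Crossing

open Finset

variable {α β κ : Type*} [Fintype α] [Fintype β] [DecidableEq α] [DecidableEq β] [DecidableEq κ]

/-- The edges of the complete bipartite graph with ends in different classes of the partition of
the vertices into the fibers of `f`. -/
def crossingEdges (f : α ⊕ β → α ⊕ β) : Finset (α × β) :=
  {e | f (.inl e.1) ≠ f (.inr e.2)}

theorem two_mul_card_color_mem_le {E : Type*} [Fintype E] (c : E → κ) (n : ℕ)
    (hc : ∀ k, 2 * #{e | c e = k} ≤ n) (S : Finset κ) : 2 * #{e | c e ∈ S} ≤ n * #S := by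
  rw [card_eq_sum_card_fiberwise (f := c) (t := S) (fun e he => by simpa using he), mul_sum,
    mul_comm n, ← smul_eq_mul #S, ← sum_const]
  refine sum_le_sum fun k _ => (Nat.mul_le_mul_left 2 (card_le_card ?_)).trans (hc k)
  exact filter_subset_filter _ (filter_subset _ _)

/-- Every class other than the smallest has more than `n / 4` edges; the extra `n` pays for the
smallest. -/
theorem mul_card_le_four_mul_card_color_mem {E : Type*} [Fintype E] (c : E → κ) (n : ℕ)
    (J : Finset κ)
    (hJ : ∀ k ∈ J, ∀ l ∈ J, k ≠ l → n < 2 * (#{e | c e = k} + #{e | c e = l})) :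
    n * #J ≤ 4 * #{e | c e ∈ J} + n := by
  rcases J.eq_empty_or_nonempty with rfl | hne
  · simp
  obtain ⟨k, hk, hmin⟩ := J.exists_min_image (fun k => #{e | c e = k}) hne
  have h1 : n * #(J.erase k) ≤ 4 * ∑ l ∈ J.erase k, #{e | c e = l} := by
    rw [mul_sum, mul_comm n, ← smul_eq_mul #_, ← sum_const]
    refine sum_le_sum fun l hl => ?_
    have h2 := hJ k hk l (mem_of_mem_erase hl) (ne_of_mem_erase hl).symm
    have h3 := hmin l (mem_of_mem_erase hl)
    omega
  have h2 : ∑ l ∈ J.erase k, #{e | c e = l} ≤ #{e | c e ∈ J} := by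
    rw [card_eq_sum_card_fiberwise (f := c) (t := J) (fun e he => by simpa using he)]
    refine (sum_le_sum_of_subset (erase_subset k J)).trans (sum_le_sum fun l hl => ?_)
    refine card_le_card fun e he => ?_
    simp only [mem_filter, mem_univ, true_and] at he ⊢
    exact ⟨he ▸ hl, he⟩
  rw [card_erase_of_mem hk] at h1
  have h3 : n * #J = n * (#J - 1) + n := by
    have := card_pos.2 ⟨k, hk⟩
    rw [← Nat.mul_succ, Nat.succ_eq_add_one, Nat.sub_add_cancel this]
  omega

theorem card_filter_sum_type {α β : Type*} [Fintype α] [Fintype β] (p : α ⊕ β → Prop) [DecidablePred p] :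
    #{v | p v} = #{a : α | p (.inl a)} + #{b : β | p (.inr b)} := by
  simp only [card_filter, Fintype.sum_sum_type]

theorem card_image_add_card_not_fixed {V : Type*} [Fintype V] [DecidableEq V] {f : V → V}
    (hf : ∀ v, f (f v) = f v) : #(univ.image f) + #{v | f v ≠ v} = Fintype.card V := by
  have : univ.image f = ({v | f v = v} : Finset V) := by
    ext v
    simp only [mem_image, mem_univ, true_and, mem_filter]
    exact ⟨fun ⟨w, hw⟩ => by rw [← hw, hf], fun h => ⟨v, h⟩⟩
  rw [this, card_filter_add_card_filter_not, card_univ]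

/-- A non-crossing edge joins two non-representatives, or a non-representative to its own
representative. With `a` and `b` non-representatives on the two sides, there are at most `a * b + a
+ b` such edges. -/
theorem four_mul_card_not_crossing_le (f : α ⊕ β → α ⊕ β) :
    4 * #{e : α × β | e ∉ crossingEdges f} ≤ #{v | f v ≠ v} * (#{v | f v ≠ v} + 4) := by
  set R : Finset α := {a | f (.inl a) ≠ .inl a} with hR
  set R' : Finset β := {b | f (.inr b) ≠ .inr b} with hR'
  have hcard : #{v | f v ≠ v} = #R + #R' := card_filter_sum_type _
  let U₁ : Finset (α × β) := univ.filter fun e => e.1 ∈ R ∧ f (.inl e.1) = .inr e.2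
  let U₂ : Finset (α × β) := univ.filter fun e => e.2 ∈ R' ∧ f (.inr e.2) = .inl e.1
  have h₁ : #U₁ ≤ #R := by
    refine card_le_card_of_injOn Prod.fst (fun e he => (mem_filter.1 he).2.1) ?_
    rintro ⟨a, b⟩ h ⟨a', b'⟩ h' (rfl : a = a')
    have h1 := (mem_filter.1 h).2.2
    have h2 := (mem_filter.1 h').2.2
    exact Prod.ext rfl (Sum.inr.inj (h1.symm.trans h2))
  have h₂ : #U₂ ≤ #R' := by
    refine card_le_card_of_injOn Prod.snd (fun e he => (mem_filter.1 he).2.1) ?_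
    rintro ⟨a, b⟩ h ⟨a', b'⟩ h' (rfl : b = b')
    have h1 := (mem_filter.1 h).2.2
    have h2 := (mem_filter.1 h').2.2
    exact Prod.ext (Sum.inl.inj (h1.symm.trans h2)) rfl
  have hsub : ({e : α × β | e ∉ crossingEdges f} : Finset (α × β)) ⊆ R ×ˢ R' ∪ (U₁ ∪ U₂) := by
    rintro ⟨a, b⟩ he
    have he : f (.inl a) = f (.inr b) := by
      simpa only [crossingEdges, mem_filter, mem_univ, true_and, not_not] using he
    simp only [mem_union, mem_product, U₁, U₂, hR, hR', mem_filter, mem_univ, true_and]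
    by_cases ha : f (.inl a) = .inl a
    · refine Or.inr (Or.inr ⟨?_, he ▸ ha⟩)
      rw [← he, ha]
      exact Sum.inl_ne_inr
    · by_cases hb : f (.inr b) = .inr b
      · exact Or.inr (Or.inl ⟨ha, he.trans hb⟩)
      · exact Or.inl ⟨ha, hb⟩
  have h3 := (card_le_card hsub).trans (card_union_le _ _)
  have h4 := card_union_le U₁ U₂
  rw [card_product] at h3
  rw [hcard]
  have h5 : 4 * (#R * #R') ≤ (#R + #R') * (#R + #R') := by
    zify
    nlinarith [sq_nonneg ((#R : ℤ) - #R')]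
  nlinarith

/-- Partitions with few vertices in excess of the number of classes. -/
theorem card_missed_of_fine {n m : ℕ} (hα : Fintype.card α = n) (hβ : Fintype.card β = m)
    (hnm : n ≤ m) (hn : 40 ≤ n) (c : α × β → κ) (hc : ∀ k, 2 * #{e | c e = k} ≤ n)
    (hc' : ∀ k ∈ univ.image c, ∀ l ∈ univ.image c, k ≠ l →
      n < 2 * (#{e | c e = k} + #{e | c e = l}))
    {f : α ⊕ β → α ⊕ β} (hf : ∀ v, f (f v) = f v) (hfn : 2 * #{v | f v ≠ v} ≤ 3 * n)
    {S : Finset κ} (hS : #S + 2 ≤ #(univ.image f)) :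
    n * (1 + #{v | f v ≠ v} + #(univ.image c \ S)) ≤
      60 * #{e ∈ crossingEdges f | c e ∉ S} := by
  have hr := card_image_add_card_not_fixed hf
  rw [Fintype.card_sum, hα, hβ] at hr
  have h1 := two_mul_card_color_mem_le c n hc S
  have h2 := mul_card_le_four_mul_card_color_mem c n (univ.image c \ S)
    (fun k hk l hl => hc' k (mem_sdiff.1 hk).1 l (mem_sdiff.1 hl).1)
  have h3 := four_mul_card_not_crossing_le f
  have h4 : #{e | c e ∈ S} + #{e | c e ∉ S} = n * m := by
    rw [card_filter_add_card_filter_not, card_univ, Fintype.card_prod, hα, hβ]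
  have h5 : #{e | c e ∈ univ.image c \ S} = #{e | c e ∉ S} := by
    congr 1
    ext e
    simp
  have h6 : #{e | c e ∉ S} ≤ #{e ∈ crossingEdges f | c e ∉ S} +
      #{e : α × β | e ∉ crossingEdges f} := by
    refine (card_le_card fun e he => ?_).trans (card_union_le _ _)
    simp only [mem_filter, mem_univ, true_and, mem_union] at he ⊢
    tauto
  rw [h5] at h2
  generalize #{e | c e ∉ S} = F at *
  generalize #{e | c e ∈ S} = F' at *
  generalize #{v | f v ≠ v} = r at *
  generalize #(univ.image f) = t at *
  generalize #{e ∈ crossingEdges f | c e ∉ S} = Y at *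
  generalize #{e : α × β | e ∉ crossingEdges f} = X' at *
  generalize #(univ.image c \ S) = J at *
  generalize #S = s at *
  have h7 : (r + 2) * n ≤ 2 * F := by
    have : s + 2 + r ≤ n + m := by omega
    nlinarith
  -- This is where `40 ≤ n` is needed: the linear term of `r * (r + 4)` must fit in the slack
  -- between `15 / 8 * n * r` and `2 * n * r`.
  have h8 : 5 * X' ≤ 4 * F := by
    have : r * (2 * r) ≤ r * (3 * n) := Nat.mul_le_mul_left r hfn
    nlinarith
  nlinarith

theorem card_crossingEdges_eq_sum (f : α ⊕ β → α ⊕ β) :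
    #(crossingEdges f) = ∑ b : β, #{a : α | f (.inl a) ≠ f (.inr b)} := by
  rw [crossingEdges, card_filter, Fintype.sum_prod_type_right]
  simp only [card_filter]

theorem card_crossingEdges_eq_sum' (f : α ⊕ β → α ⊕ β) :
    #(crossingEdges f) = ∑ a : α, #{b : β | f (.inr b) ≠ f (.inl a)} := by
  rw [crossingEdges, card_filter, Fintype.sum_prod_type]
  simp only [card_filter, ne_comm]

/-- Partitions with many vertices in excess of the number of classes. -/
theorem card_missed_of_coarse {n m : ℕ} (hα : Fintype.card α = n) (hβ : Fintype.card β = m)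
    (hnm : n ≤ m) (hn : 0 < n) (c : α × β → κ) (hc : ∀ k, 2 * #{e | c e = k} ≤ n)
    (f : α ⊕ β → α ⊕ β) (hf : n + 2 * #(univ.image f) ≤ 2 * m) :
    ∃ w, ∀ S : Finset κ, #S + 2 ≤ #(univ.image f) →
      n * (1 + #{v | f v ≠ w} + #S) ≤ 60 * #{e ∈ crossingEdges f | c e ∉ S} := by
  have hα' : (univ : Finset α).Nonempty := by
    rw [← card_pos, card_univ, hα]; exact hn
  -- By averaging, some `a` has at most the mean number of crossing edges; its part plays the role
  -- of the dominant one.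
  obtain ⟨a, -, ha⟩ : ∃ a ∈ (univ : Finset α),
      n * #{b : β | f (.inr b) ≠ f (.inl a)} ≤ #(crossingEdges f) := by
    refine exists_le_of_sum_le hα' ?_
    rw [← mul_sum, ← card_crossingEdges_eq_sum', sum_const, card_univ, hα, smul_eq_mul]
  refine ⟨f (.inl a), fun S hS => ?_⟩
  have hsum : #{v | f v ≠ f (.inl a)} = #{a' : α | f (.inl a') ≠ f (.inl a)} +
    #{b : β | f (.inr b) ≠ f (.inl a)} := card_filter_sum_type _
  have hX : #{a' : α | f (.inl a') ≠ f (.inl a)} * #{b : β | f (.inr b) = f (.inl a)} ≤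
      #(crossingEdges f) := by
    rw [← card_product]
    refine card_le_card fun e he => ?_
    simp only [mem_product, mem_filter, mem_univ, true_and] at he
    simp only [crossingEdges, mem_filter, mem_univ, true_and]
    rw [he.2]
    exact he.1
  have hβs : #{b : β | f (.inr b) = f (.inl a)} + #{b : β | f (.inr b) ≠ f (.inl a)} = m := by
    rw [card_filter_add_card_filter_not, card_univ, hβ]
  have hαs : #{a' : α | f (.inl a') ≠ f (.inl a)} ≤ n := hα ▸ card_le_univ _
  set T := univ.image fun a => f (.inl a) with hT
  set B : Finset β := {b | f (.inr b) ∉ T} with hB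
  set B' : Finset β := {b | f (.inr b) ∈ T} with hB'
  have hBB : #B' + #B = m := by
    rw [card_filter_add_card_filter_not, card_univ, hβ]
  have ht : #(univ.image f) ≤ #T + #B := by
    refine (card_le_card (t := T ∪ B.image fun b => f (.inr b)) fun v hv => ?_).trans
      ((card_union_le _ _).trans (Nat.add_le_add_left card_image_le _))
    obtain ⟨x, -, rfl⟩ := mem_image.1 hv
    rw [mem_union]
    rcases x with a | b
    · exact Or.inl (mem_image_of_mem (fun a => f (.inl a)) (mem_univ a))
    · by_cases hb : f (.inr b) ∈ T
      · exact Or.inl hb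
      · exact Or.inr (mem_image_of_mem (fun b => f (.inr b)) (by simpa [hB] using hb))
  have hT0 : 0 < #T := card_pos.2 (hα'.image _)
  -- A vertex of `B` lies in a part missing `α`, so all its edges cross; any other vertex of `β` has
  -- a crossing edge to each part meeting `α` except its own.
  have hXl : #B * n + #B' * (#T - 1) ≤ #(crossingEdges f) := by
    rw [card_crossingEdges_eq_sum, ← sum_filter_add_sum_filter_not univ
      (fun b : β => f (.inr b) ∈ T), add_comm, ← smul_eq_mul, ← smul_eq_mul]
    refine Nat.add_le_add (card_nsmul_le_sum _ _ _ fun b hb => ?_)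
      (card_nsmul_le_sum _ _ _ fun b hb => ?_)
    · have : #T ≤ #(insert (f (.inr b)) (image (fun a => f (.inl a))
          ({a : α | f (.inl a) ≠ f (.inr b)} : Finset α))) := by
        refine card_le_card fun v hv => ?_
        obtain ⟨x, -, rfl⟩ := mem_image.1 hv
        rw [mem_insert]
        by_cases hx : f (.inl x) = f (.inr b)
        · exact Or.inl hx
        · exact Or.inr (mem_image_of_mem (fun a => f (.inl a)) (by simpa using hx))
      have := this.trans ((card_insert_le _ _).trans (Nat.add_le_add_right card_image_le 1))
      omega
    · rw [← hα, ← card_univ]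
      refine card_le_card fun a _ => ?_
      have hb' := (mem_filter.1 hb).2
      rw [mem_filter]
      exact ⟨mem_univ _, fun h => hb' (h ▸ mem_image_of_mem (fun a => f (.inl a)) (mem_univ a))⟩
  have h1 := two_mul_card_color_mem_le c n hc S
  have h2 : #(crossingEdges f) ≤ #{e ∈ crossingEdges f | c e ∉ S} + #{e | c e ∈ S} := by
    refine (card_le_card fun e he => ?_).trans (card_union_le _ _)
    simp only [mem_filter, mem_univ, true_and, mem_union]
    tauto
  rw [hsum]
  generalize #{e ∈ crossingEdges f | c e ∉ S} = Y at *
  generalize #(crossingEdges f) = X at *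
  generalize #{e | c e ∈ S} = F at *
  generalize #{a' : α | f (.inl a') ≠ f (.inl a)} = p at *
  generalize #{b : β | f (.inr b) ≠ f (.inl a)} = q at *
  generalize #{b : β | f (.inr b) = f (.inl a)} = q' at *
  generalize #S = s at *
  generalize #(univ.image f) = t at *
  generalize #T = τ at *
  generalize #B = b at *
  generalize #B' = b' at *
  have h3 : n * (p + q) ≤ 4 * X := by
    rcases le_or_gt (2 * q) m with h | h
    · have : p * m ≤ p * (2 * q') := Nat.mul_le_mul_left p (by omega)
      have : p * n ≤ p * m := Nat.mul_le_mul_left p hnm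
      nlinarith
    · have : n * m ≤ n * (2 * q) := Nat.mul_le_mul_left n h.le
      have : n * p ≤ n * m := Nat.mul_le_mul_left n (hαs.trans hnm)
      have : n * q ≤ n * m := Nat.mul_le_mul_left n (by omega)
      nlinarith
  have h4 : n * t ≤ 10 * Y := by
    obtain ⟨τ, rfl⟩ : ∃ k, τ = k + 1 := ⟨τ - 1, by omega⟩
    rw [Nat.add_sub_cancel] at hXl
    have hs : n * s + 2 * n ≤ n * t := by
      rw [mul_comm 2 n, ← mul_add]
      exact Nat.mul_le_mul_left n hS
    -- Colors in `S` use fewer than `n * t / 2` edges. Either `b'` is large and there are at least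
    -- `3 / 5 * n * (t - 1)` crossing edges, or `B` alone supplies more than `n * (m - 3 * n / 5)`,
    -- enough since `t ≤ m - n / 2`.
    rcases le_or_gt (3 * n) (5 * b') with h | h
    · have : 3 * n * τ ≤ 5 * b' * τ := Nat.mul_le_mul_right τ h
      have : n * t ≤ n * (τ + 1 + b) := Nat.mul_le_mul_left n ht
      nlinarith
    · have h5 : 5 * m * n ≤ (5 * b + 3 * n) * n := Nat.mul_le_mul_right n (by omega)
      have h6 : n * (n + 2 * t) ≤ n * (2 * m) := Nat.mul_le_mul_left n hf
      have h7 : n * n ≤ n * m := Nat.mul_le_mul_left n hnm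
      have h8 := Nat.zero_le (b' * τ)
      linarith
  have h5 : n * (s + 2) ≤ n * t := Nat.mul_le_mul_left n hS
  linarith

end Crossing

/-! ### Random labellings and the union bound. -/

section RandomLabelling

open Finset

/-- In a uniformly random labelling with `q` labels, a set `Y` misses a given label with
probability at most `exp (-#Y / q)`. -/
theorem card_labellings_missing_le {E : Type*} [Fintype E] [DecidableEq E] {q : ℕ} (hq : 0 < q)
    (Y : Finset E) (i : Fin q) :
    (#{ω : E → Fin q | ∀ e ∈ Y, ω e ≠ i} : ℝ) ≤
      (q : ℝ) ^ Fintype.card E * Real.exp (-(#Y / q : ℝ)) := by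
  have hq' : (0 : ℝ) < q := by exact_mod_cast hq
  have h1 : ({ω : E → Fin q | ∀ e ∈ Y, ω e ≠ i} : Finset (E → Fin q)) =
      Fintype.piFinset fun e => if e ∈ Y then univ.erase i else univ := by
    ext ω
    simp only [mem_filter, mem_univ, true_and, Fintype.mem_piFinset]
    refine forall_congr' fun e => ?_
    by_cases he : e ∈ Y <;> simp [he]
  have h2 : ∀ e, ((#(if e ∈ Y then univ.erase i else univ : Finset (Fin q)) : ℕ) : ℝ) ≤
      q * if e ∈ Y then Real.exp (-(1 / q : ℝ)) else 1 := fun e => by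
    by_cases he : e ∈ Y
    · rw [if_pos he, if_pos he, card_erase_of_mem (mem_univ i), card_univ, Fintype.card_fin,
        Nat.cast_sub (by omega)]
      have h3 := Real.add_one_le_exp (-(1 / q : ℝ))
      calc ((q : ℝ) - (1 : ℕ)) = q * (-(1 / q) + 1) := by field_simp; push_cast; ring
        _ ≤ _ := mul_le_mul_of_nonneg_left h3 hq'.le
    · simp [he]
  rw [h1, Fintype.card_piFinset, Nat.cast_prod]
  refine (prod_le_prod (fun e _ => Nat.cast_nonneg _) fun e _ => h2 e).trans_eq ?_
  rw [prod_mul_distrib, prod_const, card_univ, prod_ite_mem, univ_inter, prod_const,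
    ← Real.exp_nat_mul]
  congr 2
  ring

theorem exists_labelling {E ι : Type*} [Fintype E] {q : ℕ} (hq : 0 < q)
    (I : Finset ι) (Y : ι → Finset E) (i : ι → Fin q)
    (h : ∑ j ∈ I, Real.exp (-(#(Y j) / q : ℝ)) < 1) :
    ∃ ω : E → Fin q, ∀ j ∈ I, ∃ e ∈ Y j, ω e = i j := by
  classical
  by_contra! hcon
  have h1 : (univ : Finset (E → Fin q)) ⊆
      I.biUnion fun j => {ω : E → Fin q | ∀ e ∈ Y j, ω e ≠ i j} := fun ω _ => by
    obtain ⟨j, hj, hω⟩ := hcon ω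
    exact mem_biUnion.2 ⟨j, hj, mem_filter.2 ⟨mem_univ _, hω⟩⟩
  have h2 : ((q : ℝ) ^ Fintype.card E) ≤
      ∑ j ∈ I, (#{ω : E → Fin q | ∀ e ∈ Y j, ω e ≠ i j} : ℝ) := by
    have := (card_le_card h1).trans card_biUnion_le
    rw [card_univ, Fintype.card_fun, Fintype.card_fin] at this
    exact_mod_cast this
  have h3 := h2.trans (sum_le_sum fun j _ => card_labellings_missing_le hq (Y j) (i j))
  rw [← mul_sum] at h3
  have h4 : (0 : ℝ) < (q : ℝ) ^ Fintype.card E := by positivity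
  nlinarith

/-- The sum factors over the vertices: each contributes 1 for agreeing with `g` and `ε` for each
other value. -/
theorem sum_pow_card_ne {V W : Type*} [Fintype V] [DecidableEq V] [Fintype W] [DecidableEq W]
    (g : V → W) (ε : ℝ) :
    ∑ f : V → W, ε ^ #{v | f v ≠ g v} =
      (1 + ((Fintype.card W : ℝ) - 1) * ε) ^ Fintype.card V := by
  have h1 : ∀ f : V → W, ε ^ #{v | f v ≠ g v} = ∏ v, if f v ≠ g v then ε else 1 := fun f => by
    rw [prod_ite, prod_const, prod_const_one, mul_one]
  have h2 : ∀ v, ∑ w, (if w ≠ g v then ε else 1) = 1 + ((Fintype.card W : ℝ) - 1) * ε :=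
    fun v => by
      rw [← add_sum_erase univ _ (mem_univ (g v)), if_neg (by simp),
        sum_congr rfl fun w hw => if_pos (ne_of_mem_erase hw), sum_const,
        card_erase_of_mem (mem_univ _), card_univ, nsmul_eq_mul,
        Nat.cast_sub (Fintype.card_pos_iff.2 ⟨g v⟩), Nat.cast_one]
  rw [sum_congr rfl fun f _ => h1 f, ← Fintype.piFinset_univ,
    ← prod_univ_sum (fun _ => univ) (fun v w => if w ≠ g v then ε else 1),
    prod_congr rfl fun v _ => h2 v, prod_const, card_univ]

theorem one_add_pow_le_exp_one {x : ℝ} {k : ℕ} (hx : 0 ≤ x) (h : k * x ≤ 1) :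
    (1 + x) ^ k ≤ Real.exp 1 := by
  have h1 : 1 + x ≤ Real.exp x := by linarith [Real.add_one_le_exp x]
  calc (1 + x) ^ k ≤ Real.exp x ^ k := pow_le_pow_left₀ (by linarith) h1 k
    _ = Real.exp (k * x) := (Real.exp_nat_mul _ _).symm
    _ ≤ _ := Real.exp_le_exp.2 h

variable {α β κ : Type*} [Fintype α] [Fintype β] [DecidableEq α] [DecidableEq β] [DecidableEq κ]

/-- Summed over `f` and `S`, each weight factors as `ε * (1 + (N - 1) * ε) ^ N * (1 + ε) ^ #Q`, at
most `9 * ε` since both powers are at most `exp 1`. There are at most `N` labels and `N + 1` weights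
for each, giving at most `9 * N * (N + 1) / N ^ 4`. -/
theorem sum_missing_weights_lt_one {V : Type*} [Fintype V] [DecidableEq V] {N q : ℕ}
    (hV : Fintype.card V = N) (hN : 40 ≤ N) (hq : q ≤ N) (Q : Finset κ) (hQ : #Q ≤ N ^ 2) :
    ∑ _i : Fin q, ∑ f : V → V, ∑ S ∈ Q.powerset,
      (((N : ℝ) ^ 4)⁻¹ ^ (1 + #{v | f v ≠ v} + #(Q \ S)) +
        ∑ w : V, ((N : ℝ) ^ 4)⁻¹ ^ (1 + #{v | f v ≠ w} + #S)) < 1 := by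
  have hN' : (40 : ℝ) ≤ N := by exact_mod_cast hN
  set ε : ℝ := ((N : ℝ) ^ 4)⁻¹ with hε
  have hε0 : 0 < ε := by positivity
  have hε1 : (N : ℝ) ^ 4 * ε = 1 := mul_inv_cancel₀ (by positivity)
  have hε2 : (N : ℝ) ^ 2 * ε ≤ 1 := by
    rw [← hε1]
    exact mul_le_mul_of_nonneg_right (pow_le_pow_right₀ (by linarith) (by norm_num)) hε0.le
  have h1 : (1 + ((N : ℝ) - 1) * ε) ^ N ≤ Real.exp 1 := by
    refine one_add_pow_le_exp_one (by nlinarith) ?_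
    nlinarith
  have h2 : (1 + ε) ^ #Q ≤ Real.exp 1 := by
    refine one_add_pow_le_exp_one hε0.le (le_trans ?_ hε2)
    exact mul_le_mul_of_nonneg_right (by exact_mod_cast hQ) hε0.le
  have h3 : ∀ g : V → V, ∑ f : V → V, ε ^ #{v | f v ≠ g v} = (1 + ((N : ℝ) - 1) * ε) ^ N :=
    fun g => by rw [sum_pow_card_ne, hV]
  have h4 : ∑ S ∈ Q.powerset, ε ^ #S = (1 + ε) ^ #Q := by
    have := sum_pow_mul_eq_add_pow ε 1 Q
    simp only [one_pow, mul_one] at this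
    rw [this, add_comm]
  have h5 : ∑ S ∈ Q.powerset, ε ^ #(Q \ S) = (1 + ε) ^ #Q := by
    have := sum_pow_mul_eq_add_pow 1 ε Q
    simp only [one_pow, one_mul] at this
    rw [← this]
    exact sum_congr rfl fun S hS => by rw [card_sdiff_of_subset (mem_powerset.1 hS)]
  have h6 : ∑ f : V → V, ∑ S ∈ Q.powerset, ε ^ (1 + #{v | f v ≠ v} + #(Q \ S)) =
      ε * ((1 + ((N : ℝ) - 1) * ε) ^ N * (1 + ε) ^ #Q) := by
    rw [← h3 id, ← h5, sum_mul_sum, mul_sum]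
    refine sum_congr rfl fun f _ => ?_
    rw [mul_sum]
    exact sum_congr rfl fun S _ => by rw [pow_add, pow_add, pow_one, mul_assoc]; rfl
  have h7 : ∑ f : V → V, ∑ S ∈ Q.powerset, ∑ w : V, ε ^ (1 + #{v | f v ≠ w} + #S) =
      N * (ε * ((1 + ((N : ℝ) - 1) * ε) ^ N * (1 + ε) ^ #Q)) := by
    have h8 : ∀ w : V, ∑ f : V → V, ∑ S ∈ Q.powerset, ε ^ (1 + #{v | f v ≠ w} + #S) =
        ε * ((1 + ((N : ℝ) - 1) * ε) ^ N * (1 + ε) ^ #Q) := fun w => by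
      rw [← h3 (fun _ => w), ← h4, sum_mul_sum, mul_sum]
      refine sum_congr rfl fun f _ => ?_
      rw [mul_sum]
      exact sum_congr rfl fun S _ => by rw [pow_add, pow_add, pow_one, mul_assoc]
    rw [sum_congr rfl fun f _ => sum_comm, sum_comm, sum_congr rfl fun w _ => h8 w, sum_const,
      card_univ, hV, nsmul_eq_mul]
  have h9 : (1 + ((N : ℝ) - 1) * ε) ^ N * (1 + ε) ^ #Q ≤ 9 := by
    have he := Real.exp_one_lt_d9
    have he0 := Real.exp_pos 1
    calc _ ≤ Real.exp 1 * Real.exp 1 := mul_le_mul h1 h2 (by positivity) he0.le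
      _ ≤ 9 := by nlinarith
  simp only [sum_add_distrib]
  rw [h6, h7, sum_const, sum_const, card_univ, Fintype.card_fin, nsmul_eq_mul, nsmul_eq_mul,
    ← mul_add]
  set P := (1 + ((N : ℝ) - 1) * ε) ^ N * (1 + ε) ^ #Q
  have hq' : (q : ℝ) ≤ N := by exact_mod_cast hq
  calc (q : ℝ) * (ε * P + N * (ε * P)) = q * ((1 + N) * (ε * P)) := by ring
    _ ≤ N * ((1 + N) * (ε * 9)) := by
      refine mul_le_mul hq' ?_ ?_ (by linarith)
      · exact mul_le_mul_of_nonneg_left (mul_le_mul_of_nonneg_left h9 hε0.le) (by linarith)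
      · have : 0 ≤ (N : ℝ) - 1 := by linarith
        positivity
    _ < N ^ 4 * ε := by
      have : (N : ℝ) * ((1 + N) * 9) < N ^ 4 := by nlinarith [mul_self_nonneg (N : ℝ), sq_nonneg ((N : ℝ) ^ 2 - 18)]
      calc (N : ℝ) * ((1 + N) * (ε * 9)) = (N * ((1 + N) * 9)) * ε := by ring
        _ < _ := mul_lt_mul_of_pos_right this hε0
    _ = 1 := hε1

/-- With positive probability, a random labelling of the edges of a complete bipartite graph
gives every label class enough colors across every partition of the vertices. -/
theorem exists_labelling_colors_crossing {n m q : ℕ} (hα : Fintype.card α = n)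
    (hβ : Fintype.card β = m) (hnm : n ≤ m) (hn : 40 ≤ n) (hq : 0 < q)
    (hqn : (q : ℝ) * (240 * Real.log (n + m)) ≤ n) (c : α × β → κ)
    (hc : ∀ k, 2 * #{e | c e = k} ≤ n)
    (hc' : ∀ k ∈ univ.image c, ∀ l ∈ univ.image c, k ≠ l →
      n < 2 * (#{e | c e = k} + #{e | c e = l})) :
    ∃ ω : α × β → Fin q, ∀ i, ∀ f : α ⊕ β → α ⊕ β, (∀ v, f (f v) = f v) →
      #(univ.image f) ≤ #(image c {e | ω e = i ∧ e ∈ crossingEdges f}) + 1 := by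
  have hV : Fintype.card (α ⊕ β) = n + m := by rw [Fintype.card_sum, hα, hβ]
  have hn0 : (0 : ℝ) < n := by exact_mod_cast (by omega : 0 < n)
  have hq0 : (0 : ℝ) < q := by exact_mod_cast hq
  have hm0 : (0 : ℝ) ≤ m := Nat.cast_nonneg m
  have hN0 : (0 : ℝ) < (n : ℝ) + m := by positivity
  have hn1 : (40 : ℝ) ≤ n := by exact_mod_cast hn
  have hlog : 1 / 240 ≤ Real.log (n + m) := by
    have h1 := Real.one_sub_inv_le_log_of_pos hN0
    have h2 : ((n : ℝ) + m)⁻¹ ≤ 40⁻¹ := inv_anti₀ (by norm_num) (by linarith)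
    linarith
  have hqN : q ≤ n + m := by
    have : (q : ℝ) ≤ n := by nlinarith
    have : q ≤ n := by exact_mod_cast this
    omega
  set Q := univ.image c with hQdef
  have hQ : #Q ≤ (n + m) ^ 2 := by
    refine card_image_le.trans ?_
    rw [card_univ, Fintype.card_prod, hα, hβ]
    nlinarith
  set ε : ℝ := (((n + m : ℕ) : ℝ) ^ 4)⁻¹ with hε
  have hε0 : 0 < ε := by positivity
  -- The constant 240 is `60 * 4`: 60 from the counting bounds, 4 from the exponent in `ε`.
  have hexp : ∀ y d : ℕ, n * d ≤ 60 * y → Real.exp (-(y / q : ℝ)) ≤ ε ^ d := fun y d h => by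
    have h1 : ε = Real.exp (-(4 * Real.log (n + m))) := by
      rw [Real.exp_neg, mul_comm, Real.exp_mul, Real.exp_log hN0, hε]
      norm_cast
    rw [h1, ← Real.exp_nat_mul, Real.exp_le_exp, mul_neg, neg_le_neg_iff, le_div_iff₀ hq0]
    have h2 : (n : ℝ) * d ≤ 60 * y := by exact_mod_cast h
    have h3 := mul_le_mul_of_nonneg_right hqn (Nat.cast_nonneg (α := ℝ) d)
    linarith
  let Y : Fin q × (α ⊕ β → α ⊕ β) × Finset κ → Finset (α × β) :=
    fun j => {e ∈ crossingEdges j.2.1 | c e ∉ j.2.2}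
  let I₀ : Finset (Fin q × (α ⊕ β → α ⊕ β) × Finset κ) := univ ×ˢ (univ ×ˢ Q.powerset)
  let I := I₀.filter fun j => (∀ v, j.2.1 (j.2.1 v) = j.2.1 v) ∧ #j.2.2 + 2 ≤ #(univ.image j.2.1)
  obtain ⟨ω, hω⟩ := exists_labelling hq I Y (fun j => j.1) (by
    refine lt_of_le_of_lt ?_ (sum_missing_weights_lt_one hV (by omega) hqN Q hQ)
    have h1 : ∀ j ∈ I, Real.exp (-(#(Y j) / q : ℝ)) ≤
        ε ^ (1 + #{v | j.2.1 v ≠ v} + #(Q \ j.2.2)) +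
          ∑ w, ε ^ (1 + #{v | j.2.1 v ≠ w} + #j.2.2) := by
      rintro ⟨i, f, S⟩ hj
      obtain ⟨-, hf, hS⟩ := mem_filter.1 hj
      dsimp only at hf hS ⊢
      rcases le_or_gt (2 * #{v | f v ≠ v}) (3 * n) with h | h
      · refine (hexp _ _ (card_missed_of_fine hα hβ hnm hn c hc hc' hf h hS)).trans ?_
        exact le_add_of_nonneg_right (sum_nonneg fun w _ => (pow_pos hε0 _).le)
      · have h2 := card_image_add_card_not_fixed hf
        rw [hV] at h2
        obtain ⟨w, hw⟩ := card_missed_of_coarse hα hβ hnm (by omega) c hc f (by omega)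
        refine (hexp _ _ (hw S hS)).trans ?_
        refine le_trans ?_ (le_add_of_nonneg_left (pow_pos hε0 _).le)
        exact single_le_sum (f := fun w => ε ^ (1 + #{v | f v ≠ w} + #S))
          (fun w _ => (pow_pos hε0 _).le) (mem_univ w)
    refine (sum_le_sum h1).trans ((sum_le_sum_of_subset_of_nonneg (filter_subset _ _)
      fun j _ _ => add_nonneg (pow_pos hε0 _).le (sum_nonneg fun w _ => (pow_pos hε0 _).le)).trans
        (le_of_eq ?_))
    rw [sum_product]
    exact sum_congr rfl fun i _ => by rw [sum_product])
  refine ⟨ω, fun i f hf => ?_⟩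
  by_contra! hlt
  -- A failing partition gives the event for the colors it does see: no edge labelled `i` crosses
  -- with a color outside `S`.
  set S := image c {e | ω e = i ∧ e ∈ crossingEdges f} with hS
  obtain ⟨e, he, hei⟩ := hω (i, f, S) (by
    refine mem_filter.2 ⟨mem_product.2 ⟨mem_univ _, mem_product.2 ⟨mem_univ _, ?_⟩⟩, hf, by
      dsimp only; omega⟩
    exact mem_powerset.2 (image_subset_image (subset_univ _)))
  obtain ⟨he1, he2⟩ := mem_filter.1 he
  exact he2 (mem_image_of_mem c (mem_filter.2 ⟨mem_univ _, hei, he1⟩))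

end RandomLabelling

/-! ### Assembling the trees. -/

open Finset in
/-- The main theorem, with an explicit constant and a bound in place of the floor. -/
theorem exists_disjoint_rainbow_trees {n m q : ℕ} {κ : Type*} (hnm : n ≤ m) (hn : 40 ≤ n)
    (hq : 0 < q) (hqn : (q : ℝ) * (240 * Real.log (n + m)) ≤ n)
    (c : (completeBipartiteGraph (Fin n) (Fin m)).EdgeLabeling κ)
    (hc : ∀ k : κ, 2 * (c ⁻¹' {k}).ncard ≤ n) :
    HasEdgeDisjointRainbowSpanningTrees c q := by
  classical
  have hadj : ∀ e : Fin n × Fin m, (completeBipartiteGraph (Fin n) (Fin m)).Adj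
      (.inl e.1) (.inr e.2) := fun e => Or.inl ⟨rfl, rfl⟩
  let edge : Fin n × Fin m → (completeBipartiteGraph (Fin n) (Fin m)).edgeSet :=
    fun e => ⟨s(.inl e.1, .inr e.2), hadj e⟩
  have hedge : Function.Injective fun e : Fin n × Fin m =>
      (s(.inl e.1, .inr e.2) : Sym2 (Fin n ⊕ Fin m)) := by
    intro e e' h
    rcases Sym2.eq_iff.1 h with ⟨h1, h2⟩ | ⟨h1, -⟩
    · exact Prod.ext (Sum.inl.inj h1) (Sum.inr.inj h2)
    · exact absurd h1 Sum.inl_ne_inr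
  let c₀ : Fin n × Fin m → κ := fun e => c (edge e)
  have hc₀ : ∀ k, 2 * #{e | c₀ e = k} ≤ n := fun k => by
    refine le_trans (Nat.mul_le_mul_left 2 ?_) (hc k)
    rw [← Set.ncard_coe_finset]
    refine Set.ncard_le_ncard_of_injOn edge (fun e he => (mem_filter.1 he).2) ?_
      (Set.toFinite _)
    exact fun e _ e' _ h => hedge (congrArg Subtype.val h)
  obtain ⟨d, hcd, hd, hd'⟩ := exists_merged_coloring c₀ n hc₀
  obtain ⟨ω, hω⟩ := exists_labelling_colors_crossing (Fintype.card_fin n) (Fintype.card_fin m)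
    hnm hn hq hqn d hd hd'
  have : Nonempty (Fin n ⊕ Fin m) := ⟨.inl ⟨0, by omega⟩⟩
  have htree : ∀ i, ∃ I ⊆ ({e | ω e = i} : Finset (Fin n × Fin m)),
      (edgeGraph (fun e => .inl e.1) (fun e => .inr e.2) I :
        SimpleGraph (Fin n ⊕ Fin m)).IsTree ∧ Set.InjOn d I := fun i => by
    refine exists_rainbow_tree _ _ d _ fun f hf => ?_
    have := hω i f hf
    simpa only [crossingEdges, filter_filter, mem_filter, mem_univ, true_and] using this
  choose I hI hIt hId using htree
  have hmem : ∀ i x, x ∈ (edgeGraph (fun e => .inl e.1) (fun e => .inr e.2) (I i) :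
      SimpleGraph (Fin n ⊕ Fin m)).edgeSet →
        ∃ e ∈ I i, (s(.inl e.1, .inr e.2) : Sym2 (Fin n ⊕ Fin m)) = x := fun i x hx => by
    rw [edgeGraph, SimpleGraph.edgeSet_fromEdgeSet] at hx
    exact hx.1
  refine ⟨fun i => edgeGraph (fun e => .inl e.1) (fun e => .inr e.2) (I i),
    fun i => ⟨?_, hIt i, ?_⟩, fun i j hij => ?_⟩
  · rw [← SimpleGraph.edgeSet_subset_edgeSet]
    intro x hx
    obtain ⟨e, -, rfl⟩ := hmem i x hx
    exact hadj e
  · rintro ⟨x, hx⟩ hxI ⟨y, hy⟩ hyI hxy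
    obtain ⟨e, he, rfl⟩ := hmem i x hxI
    obtain ⟨e', he', rfl⟩ := hmem i y hyI
    -- Equal colors stay equal after merging, so injectivity of `d` on the tree gives injectivity of
    -- `c`.
    obtain rfl := hId i he he' (hcd e e' hxy)
    rfl
  · rw [Set.disjoint_left]
    intro x hx hy
    obtain ⟨e, he, rfl⟩ := hmem i x hx
    obtain ⟨e', he', h⟩ := hmem j _ hy
    obtain rfl := hedge h
    exact hij ((mem_filter.1 (hI i he)).2.symm.trans (mem_filter.1 (hI j he')).2)

theorem mainTheorem2 :
    ∃ (C₀ : ℝ) (N₀ : ℕ), ∀ (C : ℝ) (n m : ℕ), C₀ ≤ C → N₀ ≤ n → n ≤ m →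
      C * Real.log ((n : ℝ) + (m : ℝ)) ≤ (n : ℝ) →
      ∀ (κ : Type*) (c : (completeBipartiteGraph (Fin n) (Fin m)).EdgeLabeling κ),
        (∀ k : κ, ((c ⁻¹' {k}).ncard : ℝ) ≤ (n : ℝ) / 2) →
        HasEdgeDisjointRainbowSpanningTrees c
          ⌊(n : ℝ) / (C * Real.log ((n : ℝ) + (m : ℝ)))⌋₊ := by
  refine ⟨240, 40, fun C n m hC hn hnm hCn κ c hc => ?_⟩
  have hn' : (40 : ℝ) ≤ n := by exact_mod_cast hn
  have hlog : 0 < Real.log ((n : ℝ) + m) :=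
    Real.log_pos (by linarith [Nat.cast_nonneg (α := ℝ) m])
  have hpos : 0 < C * Real.log ((n : ℝ) + m) := mul_pos (by linarith) hlog
  refine exists_disjoint_rainbow_trees hnm hn ?_ ?_ c fun k => ?_
  · exact Nat.floor_pos.2 ((one_le_div hpos).2 hCn)
  · calc _ ≤ (n : ℝ) / (C * Real.log ((n : ℝ) + m)) * (C * Real.log ((n : ℝ) + m)) :=
        mul_le_mul (Nat.floor_le (by positivity)) (mul_le_mul_of_nonneg_right hC hlog.le)
          (by positivity) (by positivity)
      _ = n := div_mul_cancel₀ _ hpos.ne'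
  · have := hc k
    exact_mod_cast (by linarith : (2 : ℝ) * ((c ⁻¹' {k}).ncard : ℝ) ≤ n)
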